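/- Setting. Let $V$ be a real Hilbert space, $D\ge 0$, $W_0>0$, and let $\omega_t\in\{\pm1\}$ be a binary sequence ($t\ge 1$, together with an arbitrary initial context $\omega_0,\dots,\omega_{1-D}$). Let $g_1,g_2,\ldots\in V$ with $\|g_t\|\le 1$; the context of round $t$ is the string $\omega_{t-D}\cdots\omega_{t-1}$. For a binary string $s$ with $|s|\le D$ let $g^t(s)$ be the subsequence of those $g_i$, $1\le i\le t$, for which $s$ is a suffix of the context of round $i$; let $n$ be its length and $G$ its sum. Put $$\Psi^{KT}_s(g^t)=2^n\,\frac{B\left(\frac{n+\|G\|+1}{2},\frac{n-\|G\|+1}{2}\right)}{B\left(\frac12,\frac12\right)},\qquad v^{KT}_s(g^t)=\frac{G}{n+1},$$ where $B$ is the Beta function. Define $\Psi^{CTW}(g^t)=\Psi^{CTW}_\lambda(g^t)$ ($\lambda$ the empty string) by $\Psi^{CTW}_s=\Psi^{KT}_s$ if $|s|=D$ and $\Psi^{CTW}_s=\frac12\Psi^{KT}_s+\frac12\Psi^{CTW}_{\bar1s}\Psi^{CTW}_{1s}$ if $|s|<D$, where $\bar 1=-1$. A suffix tree is a set $\mathbf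 T$ of binary strings such that no element is a suffix of another one and every semi-infinite (to the left) binary string has a suffix in $\mathbf T$; $\mathscr T_{\le D}$ is the set of suffix trees all of whose strings have length at most $D$. For $\mathbf T\in\mathscr T_{\le D}$ let $\Gamma_D(\mathbf T)=2|\mathbf T|-1-|\{s\in\mathbf T:|s|=D\}|$, $w(\mathbf T)=2^{-\Gamma_D(\mathbf T)}$, $\Psi^{KT}(g^t;\mathbf T)=\prod_{s\in\mathbf T}\Psi^{KT}_s(g^t)$, and let $s^{\mathbf T}_t$ be the unique element of $\mathbf T$ that is a suffix of the context of round $t$. The CTW OLO algorithm plays at round $t$ $$\mathbf w_t=\frac{W_{t-1}}{\Psi^{CTW}(g^{t-1})}\sum_{\mathbf T\in\mathscr T_{\le D}}w(\mathbf T)\,\Psi^{KT}(g^{t-1};\mathbf T)\,v^{KT}_{s^{\mathbf T}_t}(g^{t-1}),\qquad W_t=W_{t-1}+\langle g_t,\mathbf w_t\rangle .$$ For $u[\mathbf T]=(u_s)_{s\in\mathbf T}\in V^{\mathbf T}$ let $\mathrm{Reg}(u[\mathbf T];g^T)=\sum_{t=1}^T\langle g_t,u_{s^{\mathbf T}_t}-\mathbf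 w_t\rangle$, let $T_s=|\{t\le T:s_t^{\mathbf T}=s\}|$, and let $A=\sum_{s\in\mathbf T}T_s\|u_s\|^2$. Let $\ell(\mathbf T)=\ln(1/w(\mathbf T))$ if $D\ge1$, and $\ell(\mathbf T)=1$ if $D=0$. Corollary. Fix $D\ge 0$. (1) $\Psi^{CTW}(g^t)=\sum_{\mathbf T\in\mathscr T_{\le D}}w(\mathbf T)\,\Psi^{KT}(g^t;\mathbf T)$ for every $t\ge0$. (2) $W_T\ge W_0\,\Psi^{CTW}(g^T)$ for every $T\ge 0$. (3) $\mathrm{Reg}(u[\mathbf T];g^T)\le w(\mathbf T)W_0+\tilde O\left(\sqrt{\ell(\mathbf T)A}\right)$ as $A$ stays away from $0$. That is, for all $W_0>0$ and $\varepsilon>0$ there are $C\in\mathbb R$ and $k\in\mathbb N$ (depending only on $D,W_0,\varepsilon$) such that for all $V$, $T$, $g$, $\omega$, all $\mathbf T\in\mathscr T_{\le D}$ and all $u[\mathbf T]$ with $A\ge\varepsilon$, $$\mathrm{Reg}(u[\mathbf T];g^T)\le w(\mathbf T)W_0+C\,\bigl(\ln(2+T+A)\bigr)^k\sqrt{\ell(\mathbf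 T)\,A}.$$ (4) With leading term $W_0$ the bound is uniform in $W_0$ and $u$. That is, there are $C\in\mathbb R$ and $k\in\mathbb N$ (depending only on $D$) such that for all $V$, $W_0>0$, $T$, $g$, $\omega$, all $\mathbf T\in\mathscr T_{\le D}$ and all $u[\mathbf T]$, $$\mathrm{Reg}(u[\mathbf T];g^T)\le W_0+C\,\bigl(\ln(2+T+A/W_0^2)\bigr)^k\sqrt{\ell(\mathbf T)\,A}.$$ -/

import Mathlib

universe u

/-!
Conventions. The binary alphabet is `Bool`, with `true` for the symbol `1` and `false` for the
symbol `-1`. A string is a `List Bool` written from the oldest to the most recent symbol, so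
that "suffix" is `List.IsSuffix` (notation `<:+`) and prepending an older symbol is `List.cons`.
Rounds are numbered `1, 2, …`; `g t` is the vector and `ω t` the auxiliary symbol revealed at the
end of round `t`. Only the values `g t` with `t ≥ 1` are ever used. The auxiliary sequence is
indexed by `ℤ`, so that it carries an arbitrary initial context `ω 0, ω (-1), …` for the early
rounds.
-/

namespace CTW

noncomputable section

open scoped Classical RealInnerProductSpace

/-! ### Suffix trees -/

/-- A binary suffix set: it is proper (no element is a suffix of another one) and complete (every
semi-infinite string `… h 2, h 1, h 0` has a suffix in the set). -/
def IsSuffixTree (S : Finset (List Bool)) : Prop :=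
  (∀ s ∈ S, ∀ s' ∈ S, s <:+ s' → s = s') ∧
  (∀ h : ℕ → Bool, ∃ s ∈ S, s = ((List.range s.length).map h).reverse)

/-- All suffix trees of depth at most `D`. -/
def suffixTrees (D : ℕ) : Finset (Finset (List Bool)) :=
  ((List.finite_length_le Bool D).toFinset.powerset).filter IsSuffixTree

/-- The complexity `Γ_D(S) = 2 |S| - 1 - |{s ∈ S : |s| = D}|`. -/
def complexity (D : ℕ) (S : Finset (List Bool)) : ℤ :=
  2 * (S.card : ℤ) - 1 - ((S.filter (fun s => s.length = D)).card : ℤ)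

/-- The weight `w(S) = 2 ^ (-Γ_D(S))`. -/
def weight (D : ℕ) (S : Finset (List Bool)) : ℝ :=
  (2 : ℝ) ^ (-complexity D S)

/-- The logarithmic factor `ln (1 / w(S))`. For `D = 0` the only tree has weight `1`, so that
this logarithm is `0`; the factor is then read as `1`. -/
def logFactor (D : ℕ) (S : Finset (List Bool)) : ℝ :=
  if D = 0 then 1 else Real.log (1 / weight D S)

/-- The element of `S` that is a suffix of the string `c`. -/
def leaf (S : Finset (List Bool)) (c : List Bool) : List Bool :=
  if h : ∃ s ∈ S, s <:+ c then h.choose else []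

/-- The context `ω_{t-D} … ω_{t-1}` available at round `t`. -/
def context (D : ℕ) (ω : ℤ → Bool) (t : ℕ) : List Bool :=
  (List.range D).map (fun j => ω ((t : ℤ) - D + j))

/-- A suffix tree of depth at most `D` has exactly one element that is a suffix of a given string
of length `D`, and `leaf` returns it. -/
theorem leaf_spec {D : ℕ} {S : Finset (List Bool)} (hS : S ∈ suffixTrees D) {c : List Bool}
    (hc : c.length = D) :
    (leaf S c ∈ S ∧ leaf S c <:+ c) ∧ ∀ s ∈ S, s <:+ c → s = leaf S c := by
  simp only [suffixTrees, Finset.mem_filter, Finset.mem_powerset] at hS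
  obtain ⟨hsub, hprop, hcomp⟩ := hS
  have hex : ∃ s ∈ S, s <:+ c := by
    obtain ⟨s, hs, he⟩ := hcomp (fun i => c.reverse.getD i false)
    have hl : s.length ≤ D := by simpa using hsub hs
    refine ⟨s, hs, ?_⟩
    rw [← List.reverse_prefix]
    have h2 : s.reverse = c.reverse.take s.length := by
      apply List.ext_getElem
      · simp; omega
      · intro i h1 h2
        have h3 : s.reverse = (List.range s.length).map (fun i => c.reverse.getD i false) := by
          conv_lhs => rw [he]
          simp
        have h4 : i < c.length := by simp at h1; omega
        have h5 : s.reverse[i] =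
          ((List.range s.length).map (fun i => c.reverse.getD i false))[i]'(by
            simpa using h1) := by simp only [h3]
        rw [h5]
        simp [h4]
    rw [h2]
    exact List.take_prefix _ _
  have hl : leaf S c ∈ S ∧ leaf S c <:+ c := by
    unfold leaf
    rw [dif_pos hex]
    exact hex.choose_spec
  refine ⟨hl, fun s hs hsc => ?_⟩
  rcases List.suffix_or_suffix_of_suffix hsc hl.2 with h | h
  · exact hprop _ hs _ hl.1 h
  · exact (hprop _ hl.1 _ hs h).symm

/-! ### The Krichevsky–Trofimov potential -/

/-- The one-dimensional potential
`ψ_n(x) = 2 ^ n B((n + x + 1) / 2, (n - x + 1) / 2) / B(1 / 2, 1 / 2)`, where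
`B(x, y) = Γ(x) Γ(y) / Γ(x + y)` is the Beta function. -/
def ktPsi (n : ℕ) (x : ℝ) : ℝ :=
  2 ^ n * (ProbabilityTheory.beta ((n + x + 1) / 2) ((n - x + 1) / 2) /
    ProbabilityTheory.beta (1 / 2) (1 / 2))

/-- The rounds `1 ≤ i ≤ t` at which the string `s` is a suffix of the context. -/
def visits (D : ℕ) (ω : ℤ → Bool) (t : ℕ) (s : List Bool) : Finset ℕ :=
  (Finset.Icc 1 t).filter (fun i => s <:+ context D ω i)

variable {V : Type u} [NormedAddCommGroup V] [InnerProductSpace ℝ V]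

/-- The potential `Ψ^KT(g^t(s))` of the subsequence of `g_1, …, g_t` at node `s`. -/
def ktPotential (D : ℕ) (ω : ℤ → Bool) (g : ℕ → V) (t : ℕ) (s : List Bool) : ℝ :=
  ktPsi (visits D ω t s).card ‖∑ i ∈ visits D ω t s, g i‖

/-- The vectorial bet `v^KT(g^t(s))`: the sum of the subsequence of `g_1, …, g_t` at node `s`,
divided by its length plus one. -/
def ktBet (D : ℕ) (ω : ℤ → Bool) (g : ℕ → V) (t : ℕ) (s : List Bool) : V :=
  (1 / ((visits D ω t s).card + 1 : ℝ)) • ∑ i ∈ visits D ω t s, g i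

/-- The tree potential `Ψ^KT(g^t; S) = ∏_{s ∈ S} Ψ^KT(g^t(s))`. -/
def treePotential (D : ℕ) (ω : ℤ → Bool) (g : ℕ → V) (t : ℕ) (S : Finset (List Bool)) : ℝ :=
  ∏ s ∈ S, ktPotential D ω g t s

/-! ### Context tree weighting -/

/-- The recursion for the node potentials `Ψ^CTW_s(g^t)`; the extra argument is `D - |s|`, the
distance of the node `s` from the bottom of the context tree. -/
def ctwNode (D : ℕ) (ω : ℤ → Bool) (g : ℕ → V) (t : ℕ) : ℕ → List Bool → ℝ
  | 0, s => ktPotential D ω g t s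
  | k + 1, s =>
      1 / 2 * ktPotential D ω g t s +
        1 / 2 * (ctwNode D ω g t k (false :: s) * ctwNode D ω g t k (true :: s))

/-- The CTW potential `Ψ^CTW(g^t)`, the value of the recursion at the root. -/
def ctwPotential (D : ℕ) (ω : ℤ → Bool) (g : ℕ → V) (t : ℕ) : ℝ :=
  ctwNode D ω g t D []

/-- The vector
`u^CTW(g^t) = ∑_S w(S) Ψ^KT(g^t; S) v^KT(g^t(s))`, where `S` runs over the suffix trees of depth
at most `D` and `s` is the leaf of `S` selected by the context of round `t + 1`. -/
def ctwNumerator (D : ℕ) (ω : ℤ → Bool) (g : ℕ → V) (t : ℕ) : V :=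
  ∑ S ∈ suffixTrees D, (weight D S * treePotential D ω g t S) •
    ktBet D ω g t (leaf S (context D ω (t + 1)))

/-- The vectorial CTW bet `v^CTW(g^t) = u^CTW(g^t) / Ψ^CTW(g^t)`, used at round `t + 1`. -/
def ctwBet (D : ℕ) (ω : ℤ → Bool) (g : ℕ → V) (t : ℕ) : V :=
  (1 / ctwPotential D ω g t) • ctwNumerator D ω g t

/-- The wealth `W_t` of the CTW algorithm started with initial wealth `W₀`: at round `t + 1` the
action is `W_t v^CTW(g^t)`, and its reward is added to the wealth. -/
def wealth (D : ℕ) (ω : ℤ → Bool) (W₀ : ℝ) (g : ℕ → V) : ℕ → ℝ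
  | 0 => W₀
  | t + 1 => wealth D ω W₀ g t + ⟪g (t + 1), wealth D ω W₀ g t • ctwBet D ω g t⟫

/-- The action `W_t v^CTW(g^t)` of the CTW algorithm at round `t + 1`. -/
def action (D : ℕ) (ω : ℤ → Bool) (W₀ : ℝ) (g : ℕ → V) (t : ℕ) : V :=
  wealth D ω W₀ g t • ctwBet D ω g t

/-- The regret (difference of rewards) over rounds `1, …, T` of the CTW algorithm against the
competitor that plays `u s` whenever the leaf of `S` selected by the context is `s`. -/
def regret (D : ℕ) (ω : ℤ → Bool) (W₀ : ℝ) (g : ℕ → V) (T : ℕ) (S : Finset (List Bool))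
    (u : List Bool → V) : ℝ :=
  ∑ t ∈ Finset.range T, ⟪g (t + 1), u (leaf S (context D ω (t + 1))) - action D ω W₀ g t⟫

/-- The number of rounds `1 ≤ t ≤ T` at which the leaf of `S` selected by the context is `s`. -/
def leafCount (D : ℕ) (ω : ℤ → Bool) (T : ℕ) (S : Finset (List Bool)) (s : List Bool) : ℕ :=
  ((Finset.Icc 1 T).filter (fun t => leaf S (context D ω t) = s)).card

/-- The quantity `∑_{s ∈ S} T_s ‖u_s‖²`. -/
def energy (D : ℕ) (ω : ℤ → Bool) (T : ℕ) (S : Finset (List Bool)) (u : List Bool → V) : ℝ :=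
  ∑ s ∈ S, (leafCount D ω T S s : ℝ) * ‖u s‖ ^ 2

end

end CTW

namespace CTW

open scoped Classical RealInnerProductSpace

/-! ### The recursive structure of suffix trees -/

/-! A suffix tree other than `{[]}` is the join of two shallower trees, split by the most recent
symbol, and `weight` factors along this split. Unrolling the CTW recursion therefore yields the
weighted sum over trees (`ctwNode_eq_sum`).

For the wealth, symmetrising the Beta integral writes the KT potential as a positive mixture of
functions `cosh (c * x)`, each nondecreasing and convex in `x ^ 2`. Hence a vector step is dominated
by a mixture of the two unit steps along `±G`, where the Beta recursion is exact (`ktPsi_succ_le`).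
Each round updates one leaf per tree, so the inequality passes to products, by linearity to the CTW
mixture, and by induction to the wealth.

For the regret, rewards telescope to the wealth, which dominates the share of the single comparison
tree. A KT potential is at least `exp (x ^ 2 / (4 * n))` up to a polynomial factor. With `X ^ 2 = ∑
x ^ 2 / n`, Cauchy–Schwarz bounds the competitor's reward by `X * √A`: either `X` is logarithmic, or
`exp (X ^ 2 / 4)` pays for the reward (`sum_mul_le_prod_ktPsi_add`). This gives the uniform bound;
the bound with leading term `w(S) W₀` follows, since for `A ≥ ε` the constant can absorb `W₀`. -/

theorem mem_suffixTrees {D : ℕ} {S : Finset (List Bool)} :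
    S ∈ suffixTrees D ↔ (∀ s ∈ S, s.length ≤ D) ∧ IsSuffixTree S := by
  simp [suffixTrees, Finset.subset_iff]

/-- Appending a most recent symbol. -/
def snocEmbedding (b : Bool) : List Bool ↪ List Bool :=
  ⟨fun r => r ++ [b], fun _ _ h => List.append_cancel_right h⟩

@[simp]
theorem snocEmbedding_apply (b : Bool) (r : List Bool) : snocEmbedding b r = r ++ [b] := rfl

/-- The subtree of the strings that end with the symbol `b`, with this symbol removed. -/
noncomputable def subtree (S : Finset (List Bool)) (b : Bool) : Finset (List Bool) :=
  S.preimage (snocEmbedding b) (snocEmbedding b).injective.injOn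

/-- The tree with the two given subtrees. -/
noncomputable def joinTrees (p : Finset (List Bool) × Finset (List Bool)) :
    Finset (List Bool) :=
  p.1.map (snocEmbedding false) ∪ p.2.map (snocEmbedding true)

theorem mem_subtree {S : Finset (List Bool)} {b : Bool} {r : List Bool} :
    r ∈ subtree S b ↔ r ++ [b] ∈ S := by
  rw [subtree, Finset.mem_preimage, snocEmbedding_apply]

theorem append_mem_joinTrees {p : Finset (List Bool) × Finset (List Bool)} {b : Bool}
    {r : List Bool} : r ++ [b] ∈ joinTrees p ↔ r ∈ bif b then p.2 else p.1 := by
  cases b <;> simp [joinTrees]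

theorem nil_notMem_joinTrees (p : Finset (List Bool) × Finset (List Bool)) :
    [] ∉ joinTrees p := by
  simp [joinTrees]

theorem subtree_joinTrees (p : Finset (List Bool) × Finset (List Bool)) (b : Bool) :
    subtree (joinTrees p) b = bif b then p.2 else p.1 := by
  ext r
  rw [mem_subtree, append_mem_joinTrees]

theorem joinTrees_subtree {S : Finset (List Bool)} (h : [] ∉ S) :
    joinTrees (subtree S false, subtree S true) = S := by
  ext s
  rcases List.eq_nil_or_concat' s with rfl | ⟨r, b, rfl⟩
  · simp [h, nil_notMem_joinTrees]
  · rw [append_mem_joinTrees]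
    cases b <;> simp [mem_subtree]

theorem isSuffixTree_singleton_nil : IsSuffixTree {[]} := by
  constructor
  · simp
  · intro h
    exact ⟨[], by simp⟩

theorem eq_singleton_of_nil_mem {S : Finset (List Bool)} (hS : IsSuffixTree S) (h : [] ∈ S) :
    S = {[]} := by
  refine Finset.eq_singleton_iff_unique_mem.2 ⟨h, fun s hs => ?_⟩
  exact (hS.1 _ h _ hs (List.nil_suffix)).symm

/-- Index `0` of a history is its most recent symbol, hence the last letter of the string; removing
it shifts the history. -/
theorem range_map_reverse_succ (h : ℕ → Bool) (n : ℕ) :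
    ((List.range (n + 1)).map h).reverse =
      ((List.range n).map (fun i => h (i + 1))).reverse ++ [h 0] := by
  rw [List.range_succ_eq_map]
  simp [Function.comp_def]

theorem IsSuffixTree.subtree {S : Finset (List Bool)} (hS : IsSuffixTree S) (h : [] ∉ S)
    (b : Bool) : IsSuffixTree (subtree S b) := by
  constructor
  · intro s hs s' hs' hss
    rw [mem_subtree] at hs hs'
    refine List.append_cancel_right (hS.1 _ hs _ hs' ?_)
    obtain ⟨t, rfl⟩ := hss
    exact ⟨t, by simp⟩
  · intro f
    -- Insert `b` as the most recent symbol, so that the suffix found ends in `b`.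
    obtain ⟨s, hs, he⟩ := hS.2 (fun i => Nat.casesOn i b f)
    rcases List.eq_nil_or_concat' s with rfl | ⟨r, c, rfl⟩
    · exact absurd hs h
    · rw [List.length_append, List.length_singleton, range_map_reverse_succ] at he
      obtain ⟨h1, h2⟩ := List.append_inj' he rfl
      have h2 : c = b := by simpa using h2
      subst h2
      exact ⟨r, mem_subtree.2 hs, h1⟩

theorem isSuffixTree_joinTrees {p : Finset (List Bool) × Finset (List Bool)}
    (h1 : IsSuffixTree p.1) (h2 : IsSuffixTree p.2) : IsSuffixTree (joinTrees p) := by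
  have hb : ∀ b : Bool, IsSuffixTree (bif b then p.2 else p.1) := by
    intro b; cases b <;> assumption
  constructor
  · intro s hs s' hs' hss
    rcases List.eq_nil_or_concat' s with rfl | ⟨r, b, rfl⟩
    · exact absurd hs (nil_notMem_joinTrees p)
    rcases List.eq_nil_or_concat' s' with rfl | ⟨r', b', rfl⟩
    · exact absurd hs' (nil_notMem_joinTrees p)
    obtain ⟨t, ht⟩ := hss
    rw [← List.append_assoc] at ht
    obtain ⟨e1, e2⟩ := List.append_inj' ht rfl
    have e2 : b = b' := by simpa using e2
    subst e2
    rw [append_mem_joinTrees] at hs hs'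
    rw [(hb b).1 _ hs _ hs' ⟨t, e1⟩]
  · intro f
    obtain ⟨r, hr, he⟩ := (hb (f 0)).2 (fun i => f (i + 1))
    refine ⟨r ++ [f 0], append_mem_joinTrees.2 hr, ?_⟩
    rw [List.length_append, List.length_singleton, range_map_reverse_succ, ← he]

theorem suffixTrees_zero : suffixTrees 0 = {{[]}} := by
  ext S
  rw [mem_suffixTrees, Finset.mem_singleton]
  constructor
  · rintro ⟨h, hS⟩
    obtain ⟨s, hs, -⟩ := hS.2 (fun _ => false)
    have : s = [] := List.length_eq_zero_iff.1 (Nat.le_zero.1 (h s hs))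
    exact eq_singleton_of_nil_mem hS (this ▸ hs)
  · rintro rfl
    exact ⟨by simp, isSuffixTree_singleton_nil⟩

theorem singleton_nil_mem_suffixTrees (D : ℕ) : {[]} ∈ suffixTrees D :=
  mem_suffixTrees.2 ⟨by simp, isSuffixTree_singleton_nil⟩

theorem joinTrees_mem_suffixTrees {k : ℕ} {p : Finset (List Bool) × Finset (List Bool)}
    (hp : p ∈ suffixTrees k ×ˢ suffixTrees k) : joinTrees p ∈ suffixTrees (k + 1) := by
  rw [Finset.mem_product, mem_suffixTrees, mem_suffixTrees] at hp
  refine mem_suffixTrees.2 ⟨fun s hs => ?_, isSuffixTree_joinTrees hp.1.2 hp.2.2⟩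
  rcases List.eq_nil_or_concat' s with rfl | ⟨r, b, rfl⟩
  · simp
  · rw [append_mem_joinTrees] at hs
    cases b
    · simpa using hp.1.1 r hs
    · simpa using hp.2.1 r hs

theorem subtree_mem_suffixTrees {k : ℕ} {S : Finset (List Bool)} (hS : S ∈ suffixTrees (k + 1))
    (h : [] ∉ S) (b : Bool) : subtree S b ∈ suffixTrees k := by
  rw [mem_suffixTrees] at hS ⊢
  refine ⟨fun r hr => ?_, hS.2.subtree h b⟩
  simpa using hS.1 _ (mem_subtree.1 hr)

/-- A tree containing the empty string is `{[]}`; every other tree is determined by its two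
subtrees. -/
theorem sum_suffixTrees_succ {M : Type*} [AddCommMonoid M] (k : ℕ)
    (f : Finset (List Bool) → M) :
    ∑ S ∈ suffixTrees (k + 1), f S =
      f {[]} + ∑ p ∈ suffixTrees k ×ˢ suffixTrees k, f (joinTrees p) := by
  rw [← Finset.add_sum_erase _ _ (singleton_nil_mem_suffixTrees (k + 1))]
  congr 1
  have hne : ∀ S ∈ (suffixTrees (k + 1)).erase {[]}, S ∈ suffixTrees (k + 1) ∧ [] ∉ S := by
    intro S hS
    rw [Finset.mem_erase] at hS
    exact ⟨hS.2, fun h => hS.1 (eq_singleton_of_nil_mem (mem_suffixTrees.1 hS.2).2 h)⟩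
  symm
  refine Finset.sum_bij' (fun p _ => joinTrees p)
    (fun S _ => (subtree S false, subtree S true)) ?_ ?_ ?_ ?_ ?_
  · intro p hp
    refine Finset.mem_erase.2 ⟨fun h => ?_, joinTrees_mem_suffixTrees hp⟩
    exact nil_notMem_joinTrees p (h ▸ Finset.mem_singleton_self _)
  · intro S hS
    obtain ⟨h1, h2⟩ := hne S hS
    exact Finset.mem_product.2
      ⟨subtree_mem_suffixTrees h1 h2 false, subtree_mem_suffixTrees h1 h2 true⟩
  · intro p _
    simp [subtree_joinTrees]
  · intro S hS
    exact joinTrees_subtree (hne S hS).2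
  · intro p _
    rfl

theorem disjoint_joinTrees (p : Finset (List Bool) × Finset (List Bool)) :
    Disjoint (p.1.map (snocEmbedding false)) (p.2.map (snocEmbedding true)) := by
  rw [Finset.disjoint_left]
  intro s hs hs'
  simp only [Finset.mem_map, snocEmbedding_apply] at hs hs'
  obtain ⟨r, -, rfl⟩ := hs
  obtain ⟨r', -, h⟩ := hs'
  simpa using (List.append_inj' h rfl).2

theorem prod_joinTrees (p : Finset (List Bool) × Finset (List Bool)) (F : List Bool → ℝ) :
    ∏ s ∈ joinTrees p, F s = (∏ r ∈ p.1, F (r ++ [false])) * ∏ r ∈ p.2, F (r ++ [true]) := by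
  rw [joinTrees, Finset.prod_union (disjoint_joinTrees p)]
  simp

/-! ### Tree weights and the mixture formula -/

theorem weight_singleton_nil_zero : weight 0 {[]} = 1 := by
  simp [weight, complexity, Finset.filter_singleton]

theorem weight_singleton_nil_succ (k : ℕ) : weight (k + 1) {[]} = 1 / 2 := by
  have : (({[]} : Finset (List Bool)).filter (fun s => s.length = k + 1)) = ∅ := by
    simp [Finset.filter_singleton]
  rw [weight, complexity, this]
  norm_num

/-- Complexities add, plus one unit for the inner node at the root; strings of maximal length
correspond to those of the subtrees. The factor matches the `1 / 2` in `ctwNode`. -/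
theorem weight_joinTrees (k : ℕ) (p : Finset (List Bool) × Finset (List Bool)) :
    weight (k + 1) (joinTrees p) = 1 / 2 * (weight k p.1 * weight k p.2) := by
  have h : complexity (k + 1) (joinTrees p) = 1 + (complexity k p.1 + complexity k p.2) := by
    have h1 : (joinTrees p).card = p.1.card + p.2.card := by
      rw [joinTrees, Finset.card_union_of_disjoint (disjoint_joinTrees p)]
      simp
    have h2 : ((joinTrees p).filter (fun s => s.length = k + 1)).card =
        (p.1.filter (fun s => s.length = k)).card + (p.2.filter (fun s => s.length = k)).card := by
      rw [joinTrees, Finset.filter_union, Finset.card_union_of_disjoint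
        (Finset.disjoint_filter_filter (disjoint_joinTrees p))]
      simp [Finset.filter_map]
    simp only [complexity, h1, h2]
    push_cast
    ring
  rw [weight, weight, weight, h, neg_add, neg_add, zpow_add₀ two_ne_zero, zpow_add₀ two_ne_zero]
  norm_num

/-- The induction needs an arbitrary node `s`, with trees read relative to it. The symbol split off
at the root of the tree is the one adjacent to `s`, as in the recursion. -/
theorem ctwNode_eq_sum {V : Type*} [NormedAddCommGroup V] [InnerProductSpace ℝ V] (D : ℕ)
    (ω : ℤ → Bool) (g : ℕ → V) (t k : ℕ) (s : List Bool) :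
    ctwNode D ω g t k s =
      ∑ S ∈ suffixTrees k, weight k S * ∏ r ∈ S, ktPotential D ω g t (r ++ s) := by
  induction k generalizing s with
  | zero => simp [ctwNode, suffixTrees_zero, weight_singleton_nil_zero]
  | succ k ih =>
    rw [ctwNode, ih, ih, sum_suffixTrees_succ, weight_singleton_nil_succ, Finset.sum_mul_sum,
      ← Finset.sum_product', Finset.mul_sum]
    congr 1
    · simp
    · refine Finset.sum_congr rfl fun p _ => ?_
      rw [weight_joinTrees, prod_joinTrees]
      simp only [List.append_assoc, List.singleton_append]
      ring

theorem ctwPotential_eq_sum {V : Type*} [NormedAddCommGroup V] [InnerProductSpace ℝ V] (D : ℕ)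
    (ω : ℤ → Bool) (g : ℕ → V) (t : ℕ) :
    ctwPotential D ω g t = ∑ S ∈ suffixTrees D, weight D S * treePotential D ω g t S := by
  simp [ctwPotential, ctwNode_eq_sum, treePotential]

theorem weight_pos (D : ℕ) (S : Finset (List Bool)) : 0 < weight D S := by
  unfold weight
  positivity

/-- The number of strings of length at most `D`. -/
noncomputable def stringCount (D : ℕ) : ℕ := (List.finite_length_le Bool D).toFinset.card

theorem card_le_stringCount {D : ℕ} {S : Finset (List Bool)} (hS : S ∈ suffixTrees D) :
    S.card ≤ stringCount D :=
  Finset.card_le_card fun s hs => by simpa using (mem_suffixTrees.1 hS).1 s hs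

/-- Crude, but uniform over trees: it keeps the final constants dependent on `D` only. -/
theorem inv_two_pow_le_weight {D : ℕ} {S : Finset (List Bool)} (hS : S ∈ suffixTrees D) :
    ((2 : ℝ) ^ (2 * stringCount D))⁻¹ ≤ weight D S := by
  rw [weight, zpow_neg, ← zpow_natCast]
  refine inv_anti₀ (by positivity) (zpow_le_zpow_right₀ one_le_two ?_)
  have := card_le_stringCount hS
  unfold complexity
  push_cast
  omega

theorem one_le_complexity {D : ℕ} (hD : D ≠ 0) {S : Finset (List Bool)} (hS : S ∈ suffixTrees D) :
    1 ≤ complexity D S := by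
  rw [mem_suffixTrees] at hS
  have h1 := Finset.card_filter_le S (fun s => s.length = D)
  unfold complexity
  by_cases h : [] ∈ S
  · rw [eq_singleton_of_nil_mem hS.2 h, Finset.filter_singleton]
    simp [hD.symm]
  · have hr : ∀ b : Bool, ∃ r, r ++ [b] ∈ S := by
      intro b
      obtain ⟨r, hr, -⟩ := (hS.2.subtree h b).2 (fun _ => false)
      exact ⟨r, mem_subtree.1 hr⟩
    obtain ⟨r, hr0⟩ := hr false
    obtain ⟨r', hr1⟩ := hr true
    have : 1 < S.card := Finset.one_lt_card.2 ⟨_, hr0, _, hr1, fun e => by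
      simpa using (List.append_inj' e rfl).2⟩
    omega

/-- Inserting the logarithmic factor into a bound by `√A` thus costs only a constant. -/
theorem log_two_le_logFactor {D : ℕ} {S : Finset (List Bool)} (hS : S ∈ suffixTrees D) :
    Real.log 2 ≤ logFactor D S := by
  unfold logFactor
  split_ifs with hD
  · linarith [Real.log_two_lt_d9]
  · have h := one_le_complexity hD hS
    rw [weight, one_div, zpow_neg, inv_inv, Real.log_zpow]
    have h' : (1 : ℝ) ≤ complexity D S := by exact_mod_cast h
    have := Real.log_pos one_lt_two
    nlinarith

/-! ### The Beta integral and the Krichevsky–Trofimov potential -/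

/-- Transfers convergence and the integral formula from the complex Beta integral to real
parameters. -/
theorem cpow_mul_cpow_eq_ofReal {p q t : ℝ} (ht : t ∈ Set.Icc (0 : ℝ) 1) :
    ((t : ℂ) ^ ((p : ℂ) - 1) * (1 - (t : ℂ)) ^ ((q : ℂ) - 1)) =
      ((t ^ (p - 1) * (1 - t) ^ (q - 1) : ℝ) : ℂ) := by
  rw [Complex.ofReal_mul, Complex.ofReal_cpow ht.1, Complex.ofReal_cpow (by linarith [ht.2])]
  push_cast
  rfl

theorem intervalIntegrable_beta {p q : ℝ} (hp : 0 < p) (hq : 0 < q) :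
    IntervalIntegrable (fun t : ℝ => t ^ (p - 1) * (1 - t) ^ (q - 1)) MeasureTheory.volume 0 1 := by
  have h := Complex.betaIntegral_convergent (u := p) (v := q) (by simpa) (by simpa)
  rw [intervalIntegrable_iff_integrableOn_Ioc_of_le zero_le_one] at h ⊢
  have h2 : MeasureTheory.IntegrableOn
      (fun t : ℝ => ((t ^ (p - 1) * (1 - t) ^ (q - 1) : ℝ) : ℂ)) (Set.Ioc 0 1) :=
    h.congr_fun (fun t ht => cpow_mul_cpow_eq_ofReal ⟨ht.1.le, ht.2⟩) measurableSet_Ioc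
  have h3 := h2.re
  simp only [RCLike.re_to_complex, Complex.ofReal_re] at h3
  exact h3

theorem beta_eq_integral {p q : ℝ} (hp : 0 < p) (hq : 0 < q) :
    ProbabilityTheory.beta p q = ∫ t in (0 : ℝ)..1, t ^ (p - 1) * (1 - t) ^ (q - 1) := by
  rw [ProbabilityTheory.beta_eq_betaIntegralReal p q hp hq, Complex.betaIntegral]
  have : ∫ t in (0 : ℝ)..1, ((t : ℂ) ^ ((p : ℂ) - 1) * (1 - (t : ℂ)) ^ ((q : ℂ) - 1)) =
      ∫ t in (0 : ℝ)..1, ((t ^ (p - 1) * (1 - t) ^ (q - 1) : ℝ) : ℂ) := by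
    refine intervalIntegral.integral_congr fun t ht => ?_
    rw [Set.uIcc_of_le zero_le_one] at ht
    exact cpow_mul_cpow_eq_ofReal ht
  rw [this, intervalIntegral.integral_ofReal, Complex.ofReal_re]

theorem beta_comm (p q : ℝ) : ProbabilityTheory.beta p q = ProbabilityTheory.beta q p := by
  rw [ProbabilityTheory.beta, ProbabilityTheory.beta, mul_comm, add_comm]

theorem beta_add_one_left {p q : ℝ} (hp : 0 < p) (hq : 0 < q) :
    ProbabilityTheory.beta (p + 1) q = p / (p + q) * ProbabilityTheory.beta p q := by
  have hG := (Real.Gamma_pos_of_pos (add_pos hp hq)).ne'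
  have hpq : p + q ≠ 0 := (add_pos hp hq).ne'
  rw [ProbabilityTheory.beta, ProbabilityTheory.beta, Real.Gamma_add_one hp.ne',
    show p + 1 + q = p + q + 1 by ring, Real.Gamma_add_one hpq]
  field_simp

theorem beta_half_half : ProbabilityTheory.beta (1 / 2) (1 / 2) = Real.pi := by
  rw [ProbabilityTheory.beta, Real.Gamma_one_half_eq, Real.mul_self_sqrt Real.pi_pos.le]
  norm_num

/-- `y ↦ cosh √y` is increasing and convex. -/
theorem cosh_le_of_sq_le {a b y θ : ℝ} (h0 : 0 ≤ θ) (h1 : θ ≤ 1)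
    (h : y ^ 2 ≤ (1 - θ) * a ^ 2 + θ * b ^ 2) :
    Real.cosh y ≤ (1 - θ) * Real.cosh a + θ * Real.cosh b := by
  -- Compare power series in `y ^ 2` termwise: coefficients are nonnegative and each power is
  -- increasing and convex on `[0, ∞)`.
  refine hasSum_le (fun k => ?_) (Real.hasSum_cosh y)
    (((Real.hasSum_cosh a).mul_left (1 - θ)).add ((Real.hasSum_cosh b).mul_left θ))
  have hk : (y ^ 2) ^ k ≤ (1 - θ) * (a ^ 2) ^ k + θ * (b ^ 2) ^ k :=
    (pow_le_pow_left₀ (sq_nonneg y) h k).trans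
      ((convexOn_pow (𝕜 := ℝ) k).2 (Set.mem_Ici.2 (sq_nonneg a))
        (Set.mem_Ici.2 (sq_nonneg b)) (sub_nonneg.2 h1) h0 (by ring))
  simp only [pow_mul]
  rw [← mul_div_assoc, ← mul_div_assoc, ← add_div]
  gcongr

theorem rpow_mul_rpow_add_swap {m x t : ℝ} (h0 : 0 < t) (h1 : t < 1) :
    t ^ ((m + x + 1) / 2 - 1) * (1 - t) ^ ((m - x + 1) / 2 - 1) +
      t ^ ((m - x + 1) / 2 - 1) * (1 - t) ^ ((m + x + 1) / 2 - 1) =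
    2 * Real.exp ((m - 1) / 2 * (Real.log t + Real.log (1 - t))) *
      Real.cosh ((Real.log t - Real.log (1 - t)) / 2 * x) := by
  have h1' : 0 < 1 - t := by linarith
  rw [Real.cosh_eq, Real.rpow_def_of_pos h0, Real.rpow_def_of_pos h0, Real.rpow_def_of_pos h1',
    Real.rpow_def_of_pos h1', ← Real.exp_add, ← Real.exp_add,
    show ∀ a b c : ℝ, 2 * a * ((b + c) / 2) = a * b + a * c by intros; ring, ← Real.exp_add,
    ← Real.exp_add]
  congr 1 <;> congr 1 <;> ring

/-- Exchanging the two Beta arguments and adding turns the integrand into a positive weight times a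
`cosh` in `x`, so `cosh_le_of_sq_le` applies pointwise. -/
theorem beta_le_of_sq_le {m a b y θ : ℝ} (hy : |y| < m + 1) (ha : |a| < m + 1) (hb : |b| < m + 1)
    (h0 : 0 ≤ θ) (h1 : θ ≤ 1) (h : y ^ 2 ≤ (1 - θ) * a ^ 2 + θ * b ^ 2) :
    ProbabilityTheory.beta ((m + y + 1) / 2) ((m - y + 1) / 2) ≤
      (1 - θ) * ProbabilityTheory.beta ((m + a + 1) / 2) ((m - a + 1) / 2) +
        θ * ProbabilityTheory.beta ((m + b + 1) / 2) ((m - b + 1) / 2) := by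
  have key : ∀ x : ℝ, |x| < m + 1 →
      IntervalIntegrable (fun t : ℝ => t ^ ((m + x + 1) / 2 - 1) * (1 - t) ^ ((m - x + 1) / 2 - 1) +
        t ^ ((m - x + 1) / 2 - 1) * (1 - t) ^ ((m + x + 1) / 2 - 1)) MeasureTheory.volume 0 1 ∧
      2 * ProbabilityTheory.beta ((m + x + 1) / 2) ((m - x + 1) / 2) =
        ∫ t in (0 : ℝ)..1, (t ^ ((m + x + 1) / 2 - 1) * (1 - t) ^ ((m - x + 1) / 2 - 1) +
          t ^ ((m - x + 1) / 2 - 1) * (1 - t) ^ ((m + x + 1) / 2 - 1)) := by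
    intro x hx
    have hp : 0 < (m + x + 1) / 2 := by linarith [neg_abs_le x]
    have hq : 0 < (m - x + 1) / 2 := by linarith [le_abs_self x]
    refine ⟨(intervalIntegrable_beta hp hq).add (intervalIntegrable_beta hq hp), ?_⟩
    rw [intervalIntegral.integral_add (intervalIntegrable_beta hp hq)
      (intervalIntegrable_beta hq hp), ← beta_eq_integral hp hq, ← beta_eq_integral hq hp,
      beta_comm ((m - x + 1) / 2), two_mul]
  obtain ⟨iy, ey⟩ := key y hy
  obtain ⟨ia, ea⟩ := key a ha
  obtain ⟨ib, eb⟩ := key b hb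
  have hmain : 2 * ProbabilityTheory.beta ((m + y + 1) / 2) ((m - y + 1) / 2) ≤
      (1 - θ) * (2 * ProbabilityTheory.beta ((m + a + 1) / 2) ((m - a + 1) / 2)) +
        θ * (2 * ProbabilityTheory.beta ((m + b + 1) / 2) ((m - b + 1) / 2)) := by
    rw [ey, ea, eb, ← intervalIntegral.integral_const_mul, ← intervalIntegral.integral_const_mul,
      ← intervalIntegral.integral_add (ia.const_mul _) (ib.const_mul _)]
    refine intervalIntegral.integral_mono_on_of_le_Ioo zero_le_one iy
      ((ia.const_mul _).add (ib.const_mul _)) fun t ht => ?_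
    rw [rpow_mul_rpow_add_swap ht.1 ht.2, rpow_mul_rpow_add_swap ht.1 ht.2,
      rpow_mul_rpow_add_swap ht.1 ht.2]
    set c := (Real.log t - Real.log (1 - t)) / 2
    have hc : Real.cosh (c * y) ≤ (1 - θ) * Real.cosh (c * a) + θ * Real.cosh (c * b) := by
      refine cosh_le_of_sq_le h0 h1 ?_
      nlinarith [mul_le_mul_of_nonneg_left h (sq_nonneg c)]
    have he := Real.exp_pos ((m - 1) / 2 * (Real.log t + Real.log (1 - t)))
    nlinarith [mul_le_mul_of_nonneg_left hc he.le]
  linarith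

theorem ktPsi_pos {n : ℕ} {x : ℝ} (hx : |x| ≤ n) : 0 < ktPsi n x := by
  have hp : 0 < (n + x + 1) / 2 := by linarith [neg_abs_le x]
  have hq : 0 < (n - x + 1) / 2 := by linarith [le_abs_self x]
  have := ProbabilityTheory.beta_pos hp hq
  rw [ktPsi, beta_half_half]
  have := Real.pi_pos
  positivity

theorem ktPsi_zero : ktPsi 0 0 = 1 := by
  rw [ktPsi, beta_half_half]
  norm_num
  rw [beta_half_half, div_self Real.pi_pos.ne']

/-- The one-step inequality behind the wealth bound. -/
theorem ktPsi_succ_le {V : Type*} [NormedAddCommGroup V] [InnerProductSpace ℝ V] {n : ℕ} {G g : V}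
    (hG : ‖G‖ ≤ n) (hg : ‖g‖ ≤ 1) :
    ktPsi (n + 1) ‖G + g‖ ≤ ktPsi n ‖G‖ * (1 + ⟪g, G⟫ / (n + 1)) := by
  set x := ‖G‖ with hx
  have hx0 : 0 ≤ x := norm_nonneg G
  obtain ⟨c, hc1, hc2, hc⟩ : ∃ c : ℝ, -1 ≤ c ∧ c ≤ 1 ∧ ⟪g, G⟫ = x * c := by
    rcases hx0.eq_or_lt with h | h
    · refine ⟨0, by norm_num, by norm_num, ?_⟩
      rw [norm_eq_zero.1 h.symm]
      simp
    · have := abs_le.1 ((abs_real_inner_le_norm g G).trans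
        (mul_le_of_le_one_left (norm_nonneg G) hg))
      refine ⟨⟪g, G⟫ / x, ?_, ?_, by field_simp⟩
      · rw [le_div_iff₀ h]; linarith
      · rw [div_le_iff₀ h]; linarith
  -- The right side equals `x ^ 2 + 2 * x * c + 1`, so only `‖g‖ ≤ 1` is lost.
  have hy : ‖G + g‖ ^ 2 ≤ (1 - (1 + c) / 2) * (x - 1) ^ 2 + (1 + c) / 2 * (x + 1) ^ 2 := by
    have h2 : ‖g‖ ^ 2 ≤ 1 := pow_le_one₀ (norm_nonneg g) hg
    rw [norm_add_sq_real, real_inner_comm, hc, ← hx]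
    linarith
  have hyn : |‖G + g‖| < ((n : ℝ) + 1) + 1 := by
    rw [abs_of_nonneg (norm_nonneg _)]
    linarith [norm_add_le G g]
  have ha : |x - 1| < ((n : ℝ) + 1) + 1 := by rw [abs_lt]; constructor <;> linarith
  have hb : |x + 1| < ((n : ℝ) + 1) + 1 := by rw [abs_lt]; constructor <;> linarith
  have key := beta_le_of_sq_le hyn ha hb (by linarith) (by linarith) hy
  have hp : 0 < (n + x + 1) / 2 := by linarith
  have hq : 0 < (n - x + 1) / 2 := by linarith
  have hn : (0 : ℝ) < n + 1 := by positivity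
  have eb : ProbabilityTheory.beta (((n : ℝ) + 1 + (x + 1) + 1) / 2) ((n + 1 - (x + 1) + 1) / 2) =
      (n + x + 1) / 2 / (n + 1) * ProbabilityTheory.beta ((n + x + 1) / 2) ((n - x + 1) / 2) := by
    rw [show ((n : ℝ) + 1 + (x + 1) + 1) / 2 = (n + x + 1) / 2 + 1 by ring,
      show ((n : ℝ) + 1 - (x + 1) + 1) / 2 = (n - x + 1) / 2 by ring, beta_add_one_left hp hq,
      show (n + x + 1) / 2 + (n - x + 1) / 2 = (n : ℝ) + 1 by ring]
  have ea : ProbabilityTheory.beta (((n : ℝ) + 1 + (x - 1) + 1) / 2) ((n + 1 - (x - 1) + 1) / 2) =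
      (n - x + 1) / 2 / (n + 1) * ProbabilityTheory.beta ((n + x + 1) / 2) ((n - x + 1) / 2) := by
    rw [show ((n : ℝ) + 1 + (x - 1) + 1) / 2 = (n + x + 1) / 2 by ring,
      show ((n : ℝ) + 1 - (x - 1) + 1) / 2 = (n - x + 1) / 2 + 1 by ring, beta_comm,
      beta_add_one_left hq hp, beta_comm ((n - x + 1) / 2),
      show (n - x + 1) / 2 + (n + x + 1) / 2 = (n : ℝ) + 1 by ring]
  rw [ea, eb] at key
  have hr : (1 - (1 + c) / 2) * ((n - x + 1) / 2 / (n + 1) *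
        ProbabilityTheory.beta ((n + x + 1) / 2) ((n - x + 1) / 2)) +
      (1 + c) / 2 * ((n + x + 1) / 2 / (n + 1) *
        ProbabilityTheory.beta ((n + x + 1) / 2) ((n - x + 1) / 2)) =
      ProbabilityTheory.beta ((n + x + 1) / 2) ((n - x + 1) / 2) / 2 *
        (1 + x * c / (n + 1)) := by
    field_simp
    ring
  rw [hr] at key
  rw [ktPsi, ktPsi, beta_half_half, hc]
  push_cast
  have hpi := Real.pi_pos
  calc (2 : ℝ) ^ (n + 1) * (ProbabilityTheory.beta (((n : ℝ) + 1 + ‖G + g‖ + 1) / 2)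
        (((n : ℝ) + 1 - ‖G + g‖ + 1) / 2) / Real.pi)
      ≤ 2 ^ (n + 1) * (ProbabilityTheory.beta ((n + x + 1) / 2) ((n - x + 1) / 2) / 2 *
        (1 + x * c / (n + 1)) / Real.pi) := by gcongr
    _ = _ := by ring

/-! ### Exponential lower bound on the KT potential -/

/-- By `log y ≥ 1 - 1 / y`, the exponent is at least `(x * β - n * β ^ 2) / (1 - β ^ 2)`. The
numerator peaks at `β = x / (2 * n)` with value `x ^ 2 / (4 * n)`; the `-1` covers the width of the
window. -/
theorem exp_le_rpow_mul_rpow {n x β : ℝ} (hx : 0 ≤ x) (hxn : x ≤ n) (hn : 1 ≤ n)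
    (hβ0 : x / (2 * n) ≤ β) (hβ1 : β ≤ x / (2 * n) + 1 / (8 * n)) :
    Real.exp (x ^ 2 / (4 * n) - 1) ≤ (1 + β) ^ ((n + x) / 2) * (1 - β) ^ ((n - x) / 2) := by
  have hn0 : 0 < n := by linarith
  have h0 : 0 ≤ β := le_trans (by positivity) hβ0
  have h58 : β ≤ 5 / 8 := by
    have h1 : x / (2 * n) ≤ 1 / 2 := by rw [div_le_iff₀ (by positivity)]; linarith
    have h2 : 1 / (8 * n) ≤ 1 / 8 := by
      rw [div_le_div_iff₀ (by positivity) (by norm_num)]; linarith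
    linarith
  have hp : 0 < 1 + β := by linarith
  have hm : 0 < 1 - β := by linarith
  rw [Real.rpow_def_of_pos hp, Real.rpow_def_of_pos hm, ← Real.exp_add, Real.exp_le_exp]
  have l1 : β / (1 + β) ≤ Real.log (1 + β) := by
    have := Real.one_sub_inv_le_log_of_pos hp
    have e : 1 - (1 + β)⁻¹ = β / (1 + β) := by field_simp; ring
    linarith
  have l2 : -(β / (1 - β)) ≤ Real.log (1 - β) := by
    have := Real.one_sub_inv_le_log_of_pos hm
    have e : 1 - (1 - β)⁻¹ = -(β / (1 - β)) := by field_simp; ring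
    linarith
  have m1 := mul_le_mul_of_nonneg_right l1 (show 0 ≤ (n + x) / 2 by linarith)
  have m2 := mul_le_mul_of_nonneg_right l2 (show 0 ≤ (n - x) / 2 by linarith)
  refine le_trans ?_ (add_le_add m1 m2)
  have hq : 0 < 1 - β ^ 2 := by nlinarith
  have e : β / (1 + β) * ((n + x) / 2) + -(β / (1 - β)) * ((n - x) / 2) =
      (x * β - n * β ^ 2) / (1 - β ^ 2) := by
    rw [show 1 - β ^ 2 = (1 + β) * (1 - β) by ring]
    field_simp
    ring
  rw [e, le_div_iff₀ hq]
  obtain ⟨δ, rfl⟩ : ∃ δ, β = x / (2 * n) + δ := ⟨β - x / (2 * n), by ring⟩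
  have hδ0 : 0 ≤ δ := by linarith
  have hδ1 : n * δ ≤ 1 / 8 := by
    have : δ ≤ 1 / (8 * n) := by linarith
    rw [le_div_iff₀ (by positivity)] at this
    linarith
  have e2 : x * (x / (2 * n) + δ) - n * (x / (2 * n) + δ) ^ 2 = x ^ 2 / (4 * n) - n * δ * δ := by
    field_simp
    ring
  have hδ2 : δ ≤ 1 / 8 := by nlinarith
  have h3 : n * δ * δ ≤ 1 / 64 := by
    have := mul_le_mul hδ1 hδ2 hδ0 (by norm_num)
    linarith
  rw [e2]
  have ha : 0 ≤ x ^ 2 / (4 * n) := by positivity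
  set β := x / (2 * n) + δ
  have hb2 : β ^ 2 ≤ 25 / 64 := by nlinarith
  nlinarith [mul_nonneg ha (sq_nonneg β)]

/-- A lower bound on the Krichevsky–Trofimov potential, of the right exponential order up to a
polynomial factor. -/
theorem exp_div_le_ktPsi {n : ℕ} (hn : 1 ≤ n) {x : ℝ} (hx : 0 ≤ x) (hxn : x ≤ n) :
    Real.exp (x ^ 2 / (4 * n) - 1) / (16 * n * Real.pi) ≤ ktPsi n x := by
  have hn1 : (1 : ℝ) ≤ n := by exact_mod_cast hn
  have hn0 : (0 : ℝ) < n := by linarith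
  have hp : 0 < (n + x + 1) / 2 := by linarith
  have hq : 0 < (n - x + 1) / 2 := by linarith
  set a : ℝ := (1 + x / (2 * n)) / 2
  set b : ℝ := a + 1 / (16 * n) with hb
  have hx2 : 0 ≤ x / (2 * n) := by positivity
  have hn16 : 1 / (16 * n : ℝ) ≤ 1 / 16 := by
    rw [div_le_div_iff₀ (by positivity) (by norm_num)]; linarith
  have hx2' : x / (2 * n) ≤ 1 / 2 := by rw [div_le_iff₀ (by positivity)]; linarith
  have ha0 : 0 < a := by simp only [a]; linarith
  have hb1 : b < 1 := by simp only [b, a]; linarith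
  have hab : a ≤ b := by rw [hb]; linarith [show 0 < 1 / (16 * n : ℝ) by positivity]
  -- On this window of length `1 / (16 * n)`, `β = 2 * t - 1` is admissible; the exponents are
  -- smaller by `1 / 2`, which only helps as the bases are below `1`.
  have hpt : ∀ t ∈ Set.Icc a b, Real.exp (x ^ 2 / (4 * n) - 1) / 2 ^ n ≤
      t ^ ((n + x + 1) / 2 - 1) * (1 - t) ^ ((n - x + 1) / 2 - 1) := by
    intro t ht
    have h0 : 0 < t := ha0.trans_le ht.1
    have h1 : 0 < 1 - t := by linarith [ht.2]
    have key := exp_le_rpow_mul_rpow (β := 2 * t - 1) hx hxn hn1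
      (by have := ht.1; simp only [a] at this; linarith)
      (by
        have := ht.2
        have e : 1 / (8 * n : ℝ) = 2 * (1 / (16 * n)) := by field_simp; norm_num
        rw [e]; simp only [b, a] at this; linarith)
    rw [show 1 + (2 * t - 1) = 2 * t by ring, show 1 - (2 * t - 1) = 2 * (1 - t) by ring,
      Real.mul_rpow (by norm_num) h0.le, Real.mul_rpow (by norm_num) h1.le, mul_mul_mul_comm,
      ← Real.rpow_add (by norm_num), show (n + x) / 2 + (n - x) / 2 = (n : ℝ) by ring,
      Real.rpow_natCast] at key
    rw [div_le_iff₀' (by positivity)]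
    refine key.trans ?_
    gcongr 2 ^ n * (?_ * ?_)
    · exact Real.rpow_le_rpow_of_exponent_ge h0 (by linarith) (by linarith)
    · exact Real.rpow_le_rpow_of_exponent_ge h1 (by linarith) (by linarith)
  have hint := intervalIntegrable_beta hp hq
  have hle : (1 / (16 * n : ℝ)) * (Real.exp (x ^ 2 / (4 * n) - 1) / 2 ^ n) ≤
      ProbabilityTheory.beta ((n + x + 1) / 2) ((n - x + 1) / 2) := by
    rw [beta_eq_integral hp hq]
    calc (1 / (16 * n : ℝ)) * (Real.exp (x ^ 2 / (4 * n) - 1) / 2 ^ n)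
        = ∫ _ in a..b, Real.exp (x ^ 2 / (4 * n) - 1) / 2 ^ n := by
          rw [intervalIntegral.integral_const, hb, smul_eq_mul]; ring
      _ ≤ ∫ t in a..b, t ^ ((n + x + 1) / 2 - 1) * (1 - t) ^ ((n - x + 1) / 2 - 1) :=
          intervalIntegral.integral_mono_on hab (by simp) (hint.mono_set (by
            rw [Set.uIcc_of_le hab, Set.uIcc_of_le zero_le_one]
            exact Set.Icc_subset_Icc ha0.le hb1.le)) hpt
      _ ≤ _ := by
          refine intervalIntegral.integral_mono_interval ha0.le hab hb1.le ?_ hint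
          filter_upwards [MeasureTheory.ae_restrict_mem measurableSet_Ioc] with t ht
          exact mul_nonneg (Real.rpow_nonneg ht.1.le _)
            (Real.rpow_nonneg (by linarith [ht.2]) _)
  rw [ktPsi, beta_half_half]
  have hpi := Real.pi_pos
  calc Real.exp (x ^ 2 / (4 * n) - 1) / (16 * n * Real.pi)
      = 2 ^ n * ((1 / (16 * n : ℝ)) * (Real.exp (x ^ 2 / (4 * n) - 1) / 2 ^ n) / Real.pi) := by
        field_simp
    _ ≤ _ := by gcongr

/-! ### The wealth of the algorithm -/

theorem norm_sum_visits_le {V : Type*} [NormedAddCommGroup V] {D : ℕ} {ω : ℤ → Bool} {g : ℕ → V}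
    {T : ℕ} (hg : ∀ t ∈ Finset.Icc 1 T, ‖g t‖ ≤ 1) (s : List Bool) :
    ‖∑ i ∈ visits D ω T s, g i‖ ≤ (visits D ω T s).card := by
  simpa using norm_sum_le_of_le (visits D ω T s) (f := g) (n := fun _ => 1)
    fun i hi => hg i (Finset.mem_filter.1 hi).1

section Wealth

variable {V : Type*} [NormedAddCommGroup V] [InnerProductSpace ℝ V] {D : ℕ} {ω : ℤ → Bool}
  {g : ℕ → V}

theorem length_context (D : ℕ) (ω : ℤ → Bool) (t : ℕ) : (context D ω t).length = D := by
  simp [context]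

theorem visits_succ_of_suffix {t : ℕ} {s : List Bool} (h : s <:+ context D ω (t + 1)) :
    visits D ω (t + 1) s = insert (t + 1) (visits D ω t s) := by
  rw [visits, visits, ← Finset.insert_Icc_right_eq_Icc_add_one (by omega), Finset.filter_insert,
    if_pos h]

theorem visits_succ_of_not_suffix {t : ℕ} {s : List Bool} (h : ¬ s <:+ context D ω (t + 1)) :
    visits D ω (t + 1) s = visits D ω t s := by
  rw [visits, visits, ← Finset.insert_Icc_right_eq_Icc_add_one (by omega), Finset.filter_insert,
    if_neg h]

theorem succ_notMem_visits (t : ℕ) (s : List Bool) : t + 1 ∉ visits D ω t s := by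
  simp [visits]

theorem ktPotential_pos {T : ℕ} (hg : ∀ t ∈ Finset.Icc 1 T, ‖g t‖ ≤ 1) (s : List Bool) :
    0 < ktPotential D ω g T s :=
  ktPsi_pos (by rw [abs_of_nonneg (norm_nonneg _)]; exact norm_sum_visits_le hg s)

theorem treePotential_pos {T : ℕ} (hg : ∀ t ∈ Finset.Icc 1 T, ‖g t‖ ≤ 1)
    (S : Finset (List Bool)) : 0 < treePotential D ω g T S :=
  Finset.prod_pos fun s _ => ktPotential_pos hg s

theorem ctwPotential_pos {T : ℕ} (hg : ∀ t ∈ Finset.Icc 1 T, ‖g t‖ ≤ 1) :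
    0 < ctwPotential D ω g T := by
  rw [ctwPotential_eq_sum]
  exact Finset.sum_pos (fun S _ => mul_pos (weight_pos D S) (treePotential_pos hg S))
    ⟨_, singleton_nil_mem_suffixTrees D⟩

theorem ktPotential_succ_le {t : ℕ} (hg : ∀ i ∈ Finset.Icc 1 (t + 1), ‖g i‖ ≤ 1) {s : List Bool}
    (h : s <:+ context D ω (t + 1)) :
    ktPotential D ω g (t + 1) s ≤
      ktPotential D ω g t s * (1 + ⟪g (t + 1), ktBet D ω g t s⟫) := by
  have hg' : ∀ i ∈ Finset.Icc 1 t, ‖g i‖ ≤ 1 := fun i hi =>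
    hg i (Finset.Icc_subset_Icc_right (Nat.le_succ t) hi)
  rw [ktPotential, ktPotential, ktBet, visits_succ_of_suffix h,
    Finset.card_insert_of_notMem (succ_notMem_visits t s),
    Finset.sum_insert (succ_notMem_visits t s), add_comm (g (t + 1)), real_inner_smul_right,
    one_div_mul_eq_div]
  exact ktPsi_succ_le (norm_sum_visits_le hg' s) (hg _ (by simp))

/-- Only the leaf selected by the new context changes its factor. -/
theorem treePotential_succ_le {t : ℕ} (hg : ∀ i ∈ Finset.Icc 1 (t + 1), ‖g i‖ ≤ 1)
    {S : Finset (List Bool)} (hS : S ∈ suffixTrees D) :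
    treePotential D ω g (t + 1) S ≤ treePotential D ω g t S *
      (1 + ⟪g (t + 1), ktBet D ω g t (leaf S (context D ω (t + 1)))⟫) := by
  have hg' : ∀ i ∈ Finset.Icc 1 t, ‖g i‖ ≤ 1 := fun i hi =>
    hg i (Finset.Icc_subset_Icc_right (Nat.le_succ t) hi)
  obtain ⟨⟨hl, hls⟩, huniq⟩ := leaf_spec hS (length_context D ω (t + 1))
  set l := leaf S (context D ω (t + 1))
  rw [treePotential, treePotential, ← Finset.mul_prod_erase _ _ hl, ← Finset.mul_prod_erase _ _ hl]
  have heq : ∏ s ∈ S.erase l, ktPotential D ω g (t + 1) s =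
      ∏ s ∈ S.erase l, ktPotential D ω g t s := by
    refine Finset.prod_congr rfl fun s hs => ?_
    rw [Finset.mem_erase] at hs
    rw [ktPotential, ktPotential, visits_succ_of_not_suffix fun h => hs.1 (huniq s hs.2 h)]
  rw [heq, mul_right_comm]
  exact mul_le_mul_of_nonneg_right (ktPotential_succ_le hg hls)
    (Finset.prod_nonneg fun s _ => (ktPotential_pos hg' s).le)

theorem ctwPotential_succ_le {t : ℕ} (hg : ∀ i ∈ Finset.Icc 1 (t + 1), ‖g i‖ ≤ 1) :
    ctwPotential D ω g (t + 1) ≤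
      ctwPotential D ω g t * (1 + ⟪g (t + 1), ctwBet D ω g t⟫) := by
  have hg' : ∀ i ∈ Finset.Icc 1 t, ‖g i‖ ≤ 1 := fun i hi =>
    hg i (Finset.Icc_subset_Icc_right (Nat.le_succ t) hi)
  have hpos : 0 < ctwPotential D ω g t := ctwPotential_pos hg'
  have hr : ctwPotential D ω g t * (1 + ⟪g (t + 1), ctwBet D ω g t⟫) =
      ctwPotential D ω g t + ⟪g (t + 1), ctwNumerator D ω g t⟫ := by
    rw [ctwBet, real_inner_smul_right]
    field_simp
  rw [hr, ctwPotential_eq_sum, ctwPotential_eq_sum, ctwNumerator, inner_sum,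
    ← Finset.sum_add_distrib]
  refine Finset.sum_le_sum fun S hS => ?_
  rw [real_inner_smul_right]
  have := mul_le_mul_of_nonneg_left (treePotential_succ_le (ω := ω) hg hS) (weight_pos D S).le
  linarith

theorem mul_ctwPotential_le_wealth {W₀ : ℝ} (hW : 0 < W₀) {T : ℕ}
    (hg : ∀ t ∈ Finset.Icc 1 T, ‖g t‖ ≤ 1) :
    W₀ * ctwPotential D ω g T ≤ wealth D ω W₀ g T := by
  induction T with
  | zero =>
    have h0 : ctwPotential D ω g 0 = 1 := by
      have h1 : ∀ k s, ctwNode D ω g 0 k s = 1 := by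
        intro k
        induction k with
        | zero => intro s; simp [ctwNode, ktPotential, visits, ktPsi_zero]
        | succ k ih =>
          intro s
          rw [ctwNode, ih, ih]
          simp only [ktPotential, visits, Finset.Icc_eq_empty_of_lt zero_lt_one,
            Finset.filter_empty, Finset.card_empty, Finset.sum_empty, norm_zero, ktPsi_zero]
          norm_num
      exact h1 D []
    simp [h0, wealth]
  | succ t ih =>
    have hg' : ∀ i ∈ Finset.Icc 1 t, ‖g i‖ ≤ 1 := fun i hi =>
      hg i (Finset.Icc_subset_Icc_right (Nat.le_succ t) hi)
    have hstep := ctwPotential_succ_le (D := D) (ω := ω) hg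
    have hpos : 0 < ctwPotential D ω g t := ctwPotential_pos hg'
    -- Positivity comes from that of both potentials, without bounding the norm of the bet.
    have hfac : 0 < 1 + ⟪g (t + 1), ctwBet D ω g t⟫ :=
      pos_of_mul_pos_right ((ctwPotential_pos hg).trans_le hstep) hpos.le
    have e : wealth D ω W₀ g (t + 1) =
        wealth D ω W₀ g t * (1 + ⟪g (t + 1), ctwBet D ω g t⟫) := by
      rw [wealth, real_inner_smul_right]
      ring
    rw [e]
    calc W₀ * ctwPotential D ω g (t + 1)
        ≤ W₀ * (ctwPotential D ω g t * (1 + ⟪g (t + 1), ctwBet D ω g t⟫)) := by gcongr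
      _ = (W₀ * ctwPotential D ω g t) * (1 + ⟪g (t + 1), ctwBet D ω g t⟫) := by ring
      _ ≤ _ := mul_le_mul_of_nonneg_right (ih hg') hfac.le

end Wealth

/-! ### The regret -/

theorem exp_div_pow_le_ktPsi {n T : ℕ} (hnT : n ≤ T) {x : ℝ} (hx : 0 ≤ x) (hxn : x ≤ n) :
    Real.exp (x ^ 2 / (4 * n)) / (2 + T : ℝ) ^ 9 ≤ ktPsi n x := by
  have hT : (2 : ℝ) ≤ 2 + T := by linarith [(Nat.cast_nonneg T : (0 : ℝ) ≤ T)]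
  rcases Nat.eq_zero_or_pos n with rfl | hn
  -- An unvisited leaf: `x ^ 2 / (4 * n)` is `0 / 0 = 0`.
  · obtain rfl : x = 0 := le_antisymm (by simpa using hxn) hx
    rw [ktPsi_zero]
    simpa using inv_le_one_of_one_le₀ (one_le_pow₀ (by linarith : (1 : ℝ) ≤ 2 + T))
  · refine le_trans ?_ (exp_div_le_ktPsi hn hx hxn)
    have hn0 : (0 : ℝ) < n := by exact_mod_cast hn
    rw [Real.exp_sub, div_div]
    have hpi := Real.pi_pos
    have h1 : Real.exp 1 * (16 * n * Real.pi) ≤ (2 + T : ℝ) ^ 9 := by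
      calc Real.exp 1 * (16 * n * Real.pi) ≤ 3 * (16 * (2 + T : ℝ) * 4) := by
            have : (n : ℝ) ≤ 2 + T := by
              have : (n : ℝ) ≤ T := by exact_mod_cast hnT
              linarith
            gcongr
            · linarith [Real.exp_one_lt_d9]
            · linarith [Real.pi_lt_four]
        _ ≤ 2 ^ 8 * (2 + T : ℝ) := by linarith
        _ ≤ (2 + T : ℝ) ^ 8 * (2 + T : ℝ) := by gcongr
        _ = _ := by ring
    gcongr

theorem mul_pow_le_exp_of_lt {X M : ℝ} (R : ℕ) (hM : 2 ≤ M)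
    (h : 16 * (R + 1) * Real.log M < X) : X * M ^ R ≤ Real.exp (X ^ 2 / 4) := by
  have hL : 1 / 2 ≤ Real.log M :=
    le_trans (by linarith [Real.log_two_gt_d9]) (Real.log_le_log (by norm_num) hM)
  have hR : (0 : ℝ) ≤ R := Nat.cast_nonneg R
  have hRL : 0 ≤ R * Real.log M := by positivity
  have hX : 8 ≤ X := by nlinarith
  have e : M ^ R = Real.exp (R * Real.log M) := by
    rw [Real.exp_nat_mul, Real.exp_log (by linarith)]
  have hXe : X ≤ Real.exp X := by linarith [Real.add_one_le_exp X]
  calc X * M ^ R ≤ Real.exp X * Real.exp (R * Real.log M) := by rw [e]; gcongr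
    _ = Real.exp (X + R * Real.log M) := (Real.exp_add _ _).symm
    _ ≤ _ := Real.exp_le_exp.2 (by nlinarith)

/-- The trade-off between the reward of the competitor and the final potential. -/
theorem sum_mul_le_prod_ktPsi_add {ι : Type*} (S : Finset ι) (n : ι → ℕ) (x U : ι → ℝ)
    {N T : ℕ} {w : ℝ} (hS : S.card ≤ N) (hw : ((2 : ℝ) ^ (2 * N))⁻¹ ≤ w)
    (hnT : ∀ s ∈ S, n s ≤ T) (hx : ∀ s ∈ S, 0 ≤ x s) (hxn : ∀ s ∈ S, x s ≤ n s)
    (hU : ∀ s ∈ S, 0 ≤ U s) :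
    ∑ s ∈ S, x s * U s ≤ w * ∏ s ∈ S, ktPsi (n s) (x s) +
      16 * ((11 * N + 1 : ℕ) + 1) * Real.log (2 + T + ∑ s ∈ S, n s * U s ^ 2) *
        √(∑ s ∈ S, n s * U s ^ 2) := by
  set A := ∑ s ∈ S, n s * U s ^ 2 with hA
  set X := √(∑ s ∈ S, x s ^ 2 / n s) with hX
  set M : ℝ := 2 + T + A with hM
  have hT0 : (0 : ℝ) ≤ T := Nat.cast_nonneg T
  have hA0 : 0 ≤ A := Finset.sum_nonneg fun s _ => by positivity
  have hM2 : 2 ≤ M := by rw [hM]; linarith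
  have hTM : 2 + (T : ℝ) ≤ M := by rw [hM]; linarith
  have hw0 : 0 < w := lt_of_lt_of_le (by positivity) hw
  have hcs : ∑ s ∈ S, x s * U s ≤ X * √A := by
    have := Real.sum_sqrt_mul_sqrt_le S (f := fun s => x s ^ 2 / n s)
      (g := fun s => n s * U s ^ 2) (fun s => by positivity) (fun s => by positivity)
    refine le_trans (Finset.sum_le_sum fun s hs => ?_) this
    rw [← Real.sqrt_mul (by positivity)]
    rcases Nat.eq_zero_or_pos (n s) with h | h
    · have : x s = 0 := le_antisymm (by simpa [h] using hxn s hs) (hx s hs)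
      simp [this]
    · have h' : (n s : ℝ) ≠ 0 := by positivity
      rw [show x s ^ 2 / n s * (n s * U s ^ 2) = (x s * U s) ^ 2 by field_simp,
        Real.sqrt_sq (mul_nonneg (hx s hs) (hU s hs))]
  have hprod0 : 0 ≤ ∏ s ∈ S, ktPsi (n s) (x s) := Finset.prod_nonneg fun s hs =>
    (ktPsi_pos (by rw [abs_of_nonneg (hx s hs)]; exact hxn s hs)).le
  have hL0 : 0 ≤ Real.log M := Real.log_nonneg (by linarith)
  -- For small `X`, Cauchy–Schwarz suffices. For large `X` the potential pays; the power `11 * N +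
  -- 1` collects `9 * N` from the potentials, `2 * N` from the weight and `1` from `√A ≤ M`.
  rcases le_or_gt X (16 * ((11 * N + 1 : ℕ) + 1) * Real.log M) with h | h
  · have := mul_le_mul_of_nonneg_right h (Real.sqrt_nonneg A)
    have h2 := mul_nonneg hw0.le hprod0
    linarith
  · have key := mul_pow_le_exp_of_lt _ hM2 h
    have hexp : Real.exp (X ^ 2 / 4) / M ^ (9 * N) ≤ ∏ s ∈ S, ktPsi (n s) (x s) := by
      have e : Real.exp (X ^ 2 / 4) = ∏ s ∈ S, Real.exp (x s ^ 2 / (4 * n s)) := by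
        rw [← Real.exp_sum, hX, Real.sq_sqrt (Finset.sum_nonneg fun s _ => by positivity),
          Finset.sum_div]
        congr 1
        refine Finset.sum_congr rfl fun s _ => ?_
        rw [div_div, mul_comm (n s : ℝ)]
      calc Real.exp (X ^ 2 / 4) / M ^ (9 * N)
          ≤ Real.exp (X ^ 2 / 4) / ((2 + T : ℝ) ^ 9) ^ S.card := by
            rw [← pow_mul]
            gcongr
            calc (2 + T : ℝ) ^ (9 * S.card) ≤ M ^ (9 * S.card) := by gcongr
              _ ≤ M ^ (9 * N) := by gcongr; linarith
        _ = ∏ s ∈ S, Real.exp (x s ^ 2 / (4 * n s)) / (2 + T : ℝ) ^ 9 := by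
            rw [e, Finset.prod_div_distrib, Finset.prod_const]
        _ ≤ _ := Finset.prod_le_prod (fun s _ => by positivity)
            fun s hs => exp_div_pow_le_ktPsi (hnT s hs) (hx s hs) (hxn s hs)
    have hsq : √A ≤ M := by
      rw [Real.sqrt_le_left (by linarith)]
      nlinarith
    have hX0 : 0 ≤ X := Real.sqrt_nonneg _
    have hwM : (M ^ (2 * N))⁻¹ ≤ w := le_trans (by gcongr) hw
    have hMpos : 0 < M := by linarith
    calc ∑ s ∈ S, x s * U s ≤ X * M := hcs.trans (by gcongr)
      _ = X * M ^ (11 * N + 1) / (M ^ (2 * N) * M ^ (9 * N)) := by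
          rw [← pow_add, show 2 * N + 9 * N = 11 * N by ring, pow_succ]
          field_simp
      _ ≤ Real.exp (X ^ 2 / 4) / (M ^ (2 * N) * M ^ (9 * N)) := by gcongr
      _ = (M ^ (2 * N))⁻¹ * (Real.exp (X ^ 2 / 4) / M ^ (9 * N)) := by field_simp
      _ ≤ w * ∏ s ∈ S, ktPsi (n s) (x s) := by gcongr
      _ ≤ _ := le_add_of_nonneg_right (by positivity)

theorem energy_nonneg {V : Type*} [NormedAddCommGroup V] {D : ℕ} {ω : ℤ → Bool}
    {S : Finset (List Bool)} (T : ℕ) (u : List Bool → V) : 0 ≤ energy D ω T S u :=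
  Finset.sum_nonneg fun s _ => by positivity

section Regret

variable {V : Type*} [NormedAddCommGroup V] [InnerProductSpace ℝ V] {D : ℕ} {ω : ℤ → Bool}
  {g : ℕ → V} {S : Finset (List Bool)}

theorem filter_leaf_eq_visits (hS : S ∈ suffixTrees D) {s : List Bool} (hs : s ∈ S) (T : ℕ) :
    (Finset.Icc 1 T).filter (fun t => leaf S (context D ω t) = s) = visits D ω T s := by
  refine Finset.filter_congr fun t _ => ?_
  obtain ⟨⟨-, h1⟩, h2⟩ := leaf_spec hS (length_context D ω t)
  exact ⟨fun h => h ▸ h1, fun h => (h2 s hs h).symm⟩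

theorem wealth_eq_add_sum (W₀ : ℝ) (T : ℕ) :
    wealth D ω W₀ g T = W₀ + ∑ t ∈ Finset.range T, ⟪g (t + 1), action D ω W₀ g t⟫ := by
  induction T with
  | zero => simp [wealth]
  | succ t ih => rw [wealth, Finset.sum_range_succ, ← add_assoc, ← ih, action]

theorem sum_inner_leaf (hS : S ∈ suffixTrees D) (T : ℕ) (u : List Bool → V) :
    ∑ t ∈ Finset.range T, ⟪g (t + 1), u (leaf S (context D ω (t + 1)))⟫ =
      ∑ s ∈ S, ⟪∑ i ∈ visits D ω T s, g i, u s⟫ := by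
  have h1 : ∑ t ∈ Finset.range T, ⟪g (t + 1), u (leaf S (context D ω (t + 1)))⟫ =
      ∑ i ∈ Finset.Icc 1 T, ⟪g i, u (leaf S (context D ω i))⟫ := by
    rw [Finset.range_eq_Ico, Finset.sum_Ico_add' (fun i => ⟪g i, u (leaf S (context D ω i))⟫)]
    rfl
  rw [h1, ← Finset.sum_fiberwise_of_maps_to
    (fun i _ => (leaf_spec hS (length_context D ω i)).1.1)]
  refine Finset.sum_congr rfl fun s hs => ?_
  rw [← filter_leaf_eq_visits hS hs, sum_inner]
  refine Finset.sum_congr rfl fun i hi => ?_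
  rw [(Finset.mem_filter.1 hi).2]

/-- Drop all trees but `S` from the mixture and measure the competitor in units of `W₀`: this puts
`A / W₀ ^ 2` in the logarithm, while `W₀ * √(A / W₀ ^ 2) = √A`. -/
theorem regret_le {W₀ : ℝ} (hW : 0 < W₀) {T : ℕ} (hg : ∀ t ∈ Finset.Icc 1 T, ‖g t‖ ≤ 1)
    (hS : S ∈ suffixTrees D) (u : List Bool → V) :
    regret D ω W₀ g T S u ≤ W₀ + 32 * ((11 * stringCount D + 1 : ℕ) + 1) *
      Real.log (2 + T + energy D ω T S u / W₀ ^ 2) * √(logFactor D S * energy D ω T S u) := by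
  have hreg : regret D ω W₀ g T S u =
      W₀ + ∑ s ∈ S, ⟪∑ i ∈ visits D ω T s, g i, u s⟫ - wealth D ω W₀ g T := by
    rw [wealth_eq_add_sum, ← sum_inner_leaf hS, regret]
    simp only [inner_sub_right, Finset.sum_sub_distrib]
    ring
  have hwealth := mul_ctwPotential_le_wealth (D := D) (ω := ω) hW hg
  have htree : weight D S * treePotential D ω g T S ≤ ctwPotential D ω g T := by
    rw [ctwPotential_eq_sum]
    exact Finset.single_le_sum (f := fun S => weight D S * treePotential D ω g T S)
      (fun S _ => (mul_pos (weight_pos D S) (treePotential_pos hg S)).le) hS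
  have hcore := sum_mul_le_prod_ktPsi_add S (fun s => (visits D ω T s).card)
    (fun s => ‖∑ i ∈ visits D ω T s, g i‖) (fun s => ‖u s‖ / W₀) (T := T)
    (card_le_stringCount hS) (inv_two_pow_le_weight hS)
    (fun s _ => (Finset.card_filter_le _ _).trans (by simp)) (fun s _ => norm_nonneg _)
    (fun s _ => norm_sum_visits_le hg s) (fun s _ => by positivity)
  have hen : ∑ s ∈ S, ((visits D ω T s).card : ℝ) * (‖u s‖ / W₀) ^ 2 =
      energy D ω T S u / W₀ ^ 2 := by
    rw [energy, Finset.sum_div]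
    refine Finset.sum_congr rfl fun s hs => ?_
    rw [leafCount, filter_leaf_eq_visits hS hs, div_pow, mul_div_assoc]
  have hA := energy_nonneg (D := D) (ω := ω) (S := S) T u
  set A := energy D ω T S u
  rw [hen] at hcore
  have hsum : ∑ s ∈ S, ⟪∑ i ∈ visits D ω T s, g i, u s⟫ ≤
      W₀ * ∑ s ∈ S, ‖∑ i ∈ visits D ω T s, g i‖ * (‖u s‖ / W₀) := by
    rw [Finset.mul_sum]
    refine Finset.sum_le_sum fun s _ => (real_inner_le_norm _ _).trans_eq ?_
    field_simp
  have hsqrt : W₀ * √(A / W₀ ^ 2) = √A := by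
    rw [Real.sqrt_div hA, Real.sqrt_sq hW.le]
    field_simp
  have hsqrt2 : √A ≤ 2 * √(logFactor D S * A) := by
    have h1 : 1 / 4 ≤ logFactor D S :=
      le_trans (by linarith [Real.log_two_gt_d9]) (log_two_le_logFactor hS)
    have h2 : (2 : ℝ) = √4 := by
      rw [show (4 : ℝ) = 2 ^ 2 by norm_num, Real.sqrt_sq (by norm_num)]
    rw [h2, ← Real.sqrt_mul (by norm_num)]
    exact Real.sqrt_le_sqrt (by nlinarith)
  have hL : 0 ≤ Real.log (2 + T + A / W₀ ^ 2) := by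
    refine Real.log_nonneg ?_
    have : 0 ≤ A / W₀ ^ 2 := by positivity
    linarith [(Nat.cast_nonneg T : (0 : ℝ) ≤ T)]
  set L := Real.log (2 + T + A / W₀ ^ 2)
  set K : ℝ := ((11 * stringCount D + 1 : ℕ) : ℝ) + 1
  have hK : 0 ≤ K := by positivity
  have h1 := mul_le_mul_of_nonneg_left hcore hW.le
  have h2 := mul_le_mul_of_nonneg_left htree hW.le
  have h3 : W₀ * (16 * K * L * √(A / W₀ ^ 2)) ≤ 32 * K * L * √(logFactor D S * A) := by
    calc W₀ * (16 * K * L * √(A / W₀ ^ 2)) = 16 * K * L * (W₀ * √(A / W₀ ^ 2)) := by ring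
      _ ≤ 16 * K * L * (2 * √(logFactor D S * A)) := by rw [hsqrt]; gcongr
      _ = _ := by ring
  rw [treePotential] at h2
  simp only [ktPotential] at h2
  rw [hreg]
  linarith

/-- The argument grows by at most the factor `max 1 (1 / W₀ ^ 2)`, whose logarithm is absorbed
because the right-hand logarithm is at least `log 2`. -/
theorem log_add_div_le {W₀ : ℝ} (hW : 0 < W₀) : ∃ B : ℝ, 0 ≤ B ∧ ∀ (T : ℕ) (A : ℝ), 0 ≤ A →
    Real.log (2 + T + A / W₀ ^ 2) ≤ B * Real.log (2 + T + A) := by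
  set m : ℝ := max 1 (1 / W₀ ^ 2) with hm
  have hm1 : 1 ≤ m := le_max_left _ _
  have hlm : 0 ≤ Real.log m := Real.log_nonneg hm1
  have hl2 : 0 < Real.log 2 := Real.log_pos one_lt_two
  refine ⟨Real.log m / Real.log 2 + 1, by positivity, fun T A hA => ?_⟩
  have hT : (0 : ℝ) ≤ T := Nat.cast_nonneg T
  have h1 : 2 + T + A / W₀ ^ 2 ≤ m * (2 + T + A) := by
    have h2 : A / W₀ ^ 2 ≤ m * A := by
      rw [div_eq_mul_one_div, mul_comm]
      exact mul_le_mul_of_nonneg_right (le_max_right _ _) hA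
    nlinarith
  have h3 : Real.log 2 ≤ Real.log (2 + T + A) := Real.log_le_log (by norm_num) (by linarith)
  calc Real.log (2 + T + A / W₀ ^ 2) ≤ Real.log (m * (2 + T + A)) :=
        Real.log_le_log (by positivity) h1
    _ = Real.log m / Real.log 2 * Real.log 2 + Real.log (2 + T + A) := by
        rw [Real.log_mul (by positivity) (by positivity), div_mul_cancel₀ _ hl2.ne']
    _ ≤ Real.log m / Real.log 2 * Real.log (2 + T + A) + Real.log (2 + T + A) := by gcongr
    _ = _ := by ring

end Regret

end CTW

/-! ### Assembly of the four claims -/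

theorem mainTheorem2 (D : ℕ) :
    -- the CTW potential is the mixture of the tree potentials, and it bounds the wealth from below
    (∀ (V : Type u) [NormedAddCommGroup V] [InnerProductSpace ℝ V] [CompleteSpace V]
        (ω : ℤ → Bool) (g : ℕ → V),
      (∀ t : ℕ, CTW.ctwPotential D ω g t =
        ∑ S ∈ CTW.suffixTrees D, CTW.weight D S * CTW.treePotential D ω g t S) ∧
      (∀ (W₀ : ℝ) (T : ℕ), 0 < W₀ → (∀ t ∈ Finset.Icc 1 T, ‖g t‖ ≤ 1) →
        W₀ * CTW.ctwPotential D ω g T ≤ CTW.wealth D ω W₀ g T)) ∧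
    -- regret with leading term `w(S) W₀`; the constants may depend on `D`, `W₀` and `ε`
    (∀ W₀ ε : ℝ, 0 < W₀ → 0 < ε → ∃ (C : ℝ) (k : ℕ),
      ∀ (V : Type u) [NormedAddCommGroup V] [InnerProductSpace ℝ V] [CompleteSpace V]
        (ω : ℤ → Bool) (g : ℕ → V) (T : ℕ), (∀ t ∈ Finset.Icc 1 T, ‖g t‖ ≤ 1) →
      ∀ S ∈ CTW.suffixTrees D, ∀ u : List Bool → V, ε ≤ CTW.energy D ω T S u →
        CTW.regret D ω W₀ g T S u ≤ CTW.weight D S * W₀ +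
          C * Real.log (2 + T + CTW.energy D ω T S u) ^ k *
            Real.sqrt (CTW.logFactor D S * CTW.energy D ω T S u)) ∧
    -- uniform regret bound for all competitors; the constants depend on `D` only
    (∃ (C : ℝ) (k : ℕ),
      ∀ (V : Type u) [NormedAddCommGroup V] [InnerProductSpace ℝ V] [CompleteSpace V]
        (ω : ℤ → Bool) (W₀ : ℝ) (g : ℕ → V) (T : ℕ), 0 < W₀ →
        (∀ t ∈ Finset.Icc 1 T, ‖g t‖ ≤ 1) →
      ∀ S ∈ CTW.suffixTrees D, ∀ u : List Bool → V,
        CTW.regret D ω W₀ g T S u ≤ W₀ +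
          C * Real.log (2 + T + CTW.energy D ω T S u / W₀ ^ 2) ^ k *
            Real.sqrt (CTW.logFactor D S * CTW.energy D ω T S u)) := by
  refine ⟨fun V _ _ _ ω g => ⟨CTW.ctwPotential_eq_sum D ω g,
    fun W₀ T hW hg => CTW.mul_ctwPotential_le_wealth hW hg⟩, ?_, ?_⟩
  · intro W₀ ε hW hε
    obtain ⟨B, hB, hlog⟩ := CTW.log_add_div_le hW
    set K : ℝ := 32 * ((11 * CTW.stringCount D + 1 : ℕ) + 1) with hK
    have hK0 : 0 ≤ K := by positivity
    -- `K * B` converts the logarithm; `4 * W₀ / √ε` absorbs `W₀`, as the logarithm is at least `1 /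
    -- 2` and the square root at least `√ε / 2`. The term `w(S) W₀` is then only needed to be
    -- nonnegative.
    refine ⟨K * B + 4 * W₀ / √ε, 1, fun V _ _ _ ω g T hg S hS u hu => ?_⟩
    have h := CTW.regret_le (ω := ω) hW hg hS u
    set A := CTW.energy D ω T S u
    have hl := hlog T A (hε.le.trans hu)
    have hlF : 1 / 2 ≤ CTW.logFactor D S :=
      le_trans (by linarith [Real.log_two_gt_d9]) (CTW.log_two_le_logFactor hS)
    have hT : (0 : ℝ) ≤ T := Nat.cast_nonneg T
    have hL : 1 / 2 ≤ Real.log (2 + T + A) :=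
      le_trans (by linarith [Real.log_two_gt_d9])
        (Real.log_le_log (by norm_num) (by linarith) : Real.log 2 ≤ _)
    have hs : 1 / 2 * √ε ≤ √(CTW.logFactor D S * A) := by
      refine Real.le_sqrt_of_sq_le ?_
      rw [mul_pow, Real.sq_sqrt hε.le]
      nlinarith
    set L := Real.log (2 + T + A)
    set Q := √(CTW.logFactor D S * A)
    have hsε : 0 < √ε := Real.sqrt_pos.2 hε
    have hQ : 0 ≤ Q := Real.sqrt_nonneg _
    have hW₀ : W₀ ≤ 4 * W₀ / √ε * L * Q := by
      calc W₀ = 4 * W₀ / √ε * (1 / 2) * (1 / 2 * √ε) := by field_simp; norm_num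
        _ ≤ 4 * W₀ / √ε * L * Q := by gcongr
    have hK1 : K * Real.log (2 + T + A / W₀ ^ 2) * Q ≤ K * (B * L) * Q := by gcongr
    have hw := mul_pos (CTW.weight_pos D S) hW
    rw [pow_one]
    linarith
  · refine ⟨32 * ((11 * CTW.stringCount D + 1 : ℕ) + 1), 1,
      fun V _ _ _ ω W₀ g T hW hg S hS u => ?_⟩
    rw [pow_one]
    exact CTW.regret_le hW hg hS u
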